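/- Theorem. Let $C,C',\kappa\ge 1$ be real numbers. Let $\mathcal A$ be an infinite set with a height function $H:\mathcal A\to\mathbb R$ such that $\mathcal A(N):=\{x\in\mathcal A: H(x)\le N\}$ is finite for every real $N$. For every prime $p$ let $f_p:\mathcal A\to\{c\in\mathbb Z:|c|\le C\}$ be a function, and let $Y_p$ be an integer-valued random variable with $|Y_p|\le C$ almost surely, where $(Y_p)_p$ are mutually independent random variables on a common probability space with probability measure $\mathbf P$ and expectation $\mathbf E$. Let $E(N)$ and $Q(N)$ be positive real-valued functions of the real variable $N$, with $E(N)\ge 1$ for all sufficiently large $N$ and $\log Q(N)=o(\log E(N))$ as $N\to\infty$. Assume that there is a constant $K$ such that for every real $N\ge C'$ for which $\mathcal A(N)$ is nonempty, every squarefree positive integer $q$, and every tuple $(\lambda_p)_{p\mid q}$ of non-zero integers indexed by the primes dividing $q$, $$\left|\frac{\left|\{x\in\mathcal A(N): f_p(x)=\lambda_p\text{ for all primes }p\mid q\}\right|}{|\mathcal A(N)|}-\prod_{p\mid q}\mathbf P(Y_p=\lambda_p)\right|\le K\,\frac{q^{\kappa}}{E(N)}.$$ For real $Q>0$ put $$\mu(Q):=\sum_{p\le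 Q}\mathbf E[Y_p],\qquad \sigma(Q):=\Big(\sum_{p\le Q}\mathbf E\big[(Y_p-\mathbf E[Y_p])^2\big]\Big)^{1/2},$$ the sums being over primes, and assume that $\sigma(Q(N))\to\infty$ as $N\to\infty$. Equip $\mathcal A(N)$ (for $N$ such that it is nonempty) with the uniform probability measure. Then the random variable on $\mathcal A(N)$ $$x\mapsto\frac{\sum_{p\le Q(N)}f_p(x)-\mu(Q(N))}{\sigma(Q(N))}$$ converges in distribution to a standard Gaussian random variable as $N\to\infty$. -/

import Mathlib

open Filter Asymptotics MeasureTheory ProbabilityTheory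

/-- A height function on a set: real-valued, with finitely many elements up to any given height. -/
structure HeightFunction (A : Type*) where
  /-- the height of an element -/
  height : A → ℝ
  finite_le : ∀ N : ℝ, {x : A | height x ≤ N}.Finite

namespace HeightFunction

variable {A : Type*} (H : HeightFunction A)

/-- `A(N)`, the set of all elements of height at most `N`. -/
def upTo (N : ℝ) : Set A := {x | H.height x ≤ N}

/-- The real numbers `N` such that `A(N)` is nonempty. -/
abbrev Cutoff : Type := {N : ℝ // (H.upTo N).Nonempty}

/-- The filter of `N → ∞` on those `N` for which `A(N)` is nonempty. -/
def cutoffAtTop : Filter H.Cutoff := comap (fun N => (N : ℝ)) atTop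

instance instFiniteUpTo (N : ℝ) : Finite (H.upTo N) := (H.finite_le N).to_subtype

instance instNonemptyUpTo (N : H.Cutoff) : Nonempty (H.upTo N) := N.2.to_subtype

/-- The uniform probability measure on `A(N)` (all subsets being measurable). -/
noncomputable def uniform (N : H.Cutoff) : @Measure (H.upTo N) ⊤ :=
  @uniformOn (H.upTo N) ⊤ Set.univ

instance instIsProbabilityMeasureUniform (N : H.Cutoff) :
    @IsProbabilityMeasure (H.upTo N) ⊤ (H.uniform N) := by
  let _ : MeasurableSpace (H.upTo N) := ⊤
  exact instIsProbabilityMeasure_uniformOn_univ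

end HeightFunction

section Moments

variable {Ω : Type*} [MeasurableSpace Ω]

/-- `μ(Q) = ∑_{p ≤ Q} 𝐄[Y_p]`, the sum being over primes. -/
noncomputable def meanUpTo (P : Measure Ω) (Y : ℕ → Ω → ℤ) (Q : ℝ) : ℝ :=
  ∑ p ∈ Nat.primesLE ⌊Q⌋₊, ∫ ω, (Y p ω : ℝ) ∂P

/-- `σ(Q)`, the nonnegative square root of `∑_{p ≤ Q} 𝐄[(Y_p - 𝐄[Y_p])²]`. -/
noncomputable def stdDevUpTo (P : Measure Ω) (Y : ℕ → Ω → ℤ) (Q : ℝ) : ℝ :=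
  Real.sqrt (∑ p ∈ Nat.primesLE ⌊Q⌋₊, ∫ ω, ((Y p ω : ℝ) - ∫ ω', (Y p ω' : ℝ) ∂P) ^ 2 ∂P)

end Moments

open scoped Topology

/-! By Lévy's theorem it suffices to show, for each real `t`, that the characteristic function of
the normalised sum `X` of the `f p` tends to `exp (-t²/2)`. Let `Z` be the corresponding normalised
sum of the independent `Y p`. For `Z` this is a central limit theorem for bounded variables, with an
error governed by `C / σ`.

To pass from `Z` to `X`, compare moments of order at most `2m`. Expanding such a moment gives
expectations of monomials in at most `2m` of the variables. Only tuples of nonzero values contribute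
to these, and the hypothesis controls exactly those, with moduli `q ≤ Q ^ (2m)`. So the moments
differ by `O(Q ^ (2m(1 + κ)) / E)`, which tends to `0` since `Q` is smaller than every positive
power of `E`.

The moments of `Z` are bounded through its exponential moments, so cutting the series of `exp (itX)`
and `exp (itZ)` at degree `2m` costs only `O_t(4 ^ (-m))` plus the moment error. Choosing `m` first
and then letting `N → ∞` finishes the proof. The comparison is
`norm_integral_cexp_sub_integral_cexp_le`, and all errors are collected in
`norm_integral_cexp_normalized_sum_sub_exp_le`. -/

/-! ### Elementary inequalities for `exp (ix)` and for products. -/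

theorem hasDerivAt_cexp_sub_taylor (n : ℕ) (x : ℝ) :
    HasDerivAt (fun y : ℝ => Complex.exp (y * Complex.I) -
        ∑ k ∈ Finset.range (n + 1), (y * Complex.I) ^ k / (k.factorial : ℂ))
      (Complex.I * (Complex.exp (x * Complex.I) -
        ∑ k ∈ Finset.range n, (x * Complex.I) ^ k / (k.factorial : ℂ))) x := by
  have h0 : HasDerivAt (fun y : ℝ => (y : ℂ) * Complex.I) Complex.I x := by
    simpa using (Complex.ofRealCLM.hasDerivAt (x := x)).mul_const Complex.I
  have h1 := h0.cexp
  have h2 : HasDerivAt (fun y : ℝ => ∑ k ∈ Finset.range (n + 1),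
      (y * Complex.I) ^ k / (k.factorial : ℂ))
      (∑ k ∈ Finset.range (n + 1), (k * (x * Complex.I) ^ (k - 1) * Complex.I) / (k.factorial : ℂ))
      x := HasDerivAt.fun_sum fun k _ => (h0.pow k).div_const _
  refine (h1.sub h2).congr_deriv ?_
  rw [Finset.sum_range_succ', mul_sub, Finset.mul_sum]
  simp only [Nat.cast_zero, zero_mul, zero_div, add_zero, Nat.add_sub_cancel]
  congr 1
  · ring
  · refine Finset.sum_congr rfl fun k _ => ?_
    rw [Nat.factorial_succ]
    push_cast
    have : (k.factorial : ℂ) ≠ 0 := by exact_mod_cast k.factorial_ne_zero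
    have : (k : ℂ) + 1 ≠ 0 := by exact_mod_cast k.succ_ne_zero
    field_simp

/-- Each remainder has as derivative `I` times the preceding one, so the bound is integrated up
inductively from `‖exp (ix)‖ = 1`. -/
theorem norm_cexp_sub_taylor_le_of_nonneg (n : ℕ) {x : ℝ} (hx : 0 ≤ x) :
    ‖Complex.exp (x * Complex.I) -
        ∑ k ∈ Finset.range n, (x * Complex.I) ^ k / (k.factorial : ℂ)‖ ≤
      x ^ n / n.factorial := by
  induction n generalizing x with
  | zero => simp [Complex.norm_exp_ofReal_mul_I]
  | succ n ih =>
    refine image_norm_le_of_norm_deriv_right_le_deriv_boundary (a := 0) (b := x)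
      (f := fun y : ℝ => Complex.exp (y * Complex.I) -
        ∑ k ∈ Finset.range (n + 1), (y * Complex.I) ^ k / (k.factorial : ℂ))
      (B := fun y => y ^ (n + 1) / (n + 1).factorial) (B' := fun y => y ^ n / n.factorial)
      (fun y _ => (hasDerivAt_cexp_sub_taylor n y).continuousAt.continuousWithinAt)
      (fun y _ => (hasDerivAt_cexp_sub_taylor n y).hasDerivWithinAt) ?_ ?_ ?_ ⟨hx, le_rfl⟩
    · simp [Finset.sum_range_succ']
    · intro y
      refine ((hasDerivAt_pow (n + 1) y).div_const _).congr_deriv ?_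
      rw [Nat.factorial_succ]
      push_cast
      have : (n.factorial : ℝ) ≠ 0 := by exact_mod_cast n.factorial_ne_zero
      field_simp
    · intro y hy
      rw [norm_mul, Complex.norm_I, one_mul]
      exact ih hy.1

/-- Taylor's formula for `exp (i x)`, with the Lagrange bound for the remainder. -/
theorem norm_cexp_sub_taylor_le (n : ℕ) (x : ℝ) :
    ‖Complex.exp (x * Complex.I) -
        ∑ k ∈ Finset.range n, (x * Complex.I) ^ k / (k.factorial : ℂ)‖ ≤
      |x| ^ n / n.factorial := by
  rcases le_total 0 x with hx | hx
  · rw [abs_of_nonneg hx]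
    exact norm_cexp_sub_taylor_le_of_nonneg n hx
  · rw [abs_of_nonpos hx]
    -- Complex conjugation exchanges `x` and `-x`.
    refine le_trans (le_of_eq ?_) (norm_cexp_sub_taylor_le_of_nonneg n (neg_nonneg.2 hx))
    rw [← Complex.norm_conj]
    simp [← Complex.exp_conj]

/-- Telescoping: one factor is exchanged at a time, and the remaining ones have norm at most `1`. -/
theorem norm_prod_sub_prod_le_sum {ι : Type*} (s : Finset ι) {a b : ι → ℂ}
    (ha : ∀ i ∈ s, ‖a i‖ ≤ 1) (hb : ∀ i ∈ s, ‖b i‖ ≤ 1) :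
    ‖∏ i ∈ s, a i - ∏ i ∈ s, b i‖ ≤ ∑ i ∈ s, ‖a i - b i‖ := by
  classical
  induction s using Finset.induction_on with
  | empty => simp
  | insert j s hj ih =>
    rw [Finset.prod_insert hj, Finset.prod_insert hj, Finset.sum_insert hj]
    have ih' := ih (fun i hi => ha i (Finset.mem_insert_of_mem hi))
      (fun i hi => hb i (Finset.mem_insert_of_mem hi))
    have h1 : ‖∏ i ∈ s, a i‖ ≤ 1 := by
      rw [norm_prod]
      exact Finset.prod_le_one (fun _ _ => norm_nonneg _)
        fun i hi => ha i (Finset.mem_insert_of_mem hi)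
    have h2 := hb j (Finset.mem_insert_self j s)
    calc ‖a j * ∏ i ∈ s, a i - b j * ∏ i ∈ s, b i‖
        = ‖(a j - b j) * ∏ i ∈ s, a i + b j * (∏ i ∈ s, a i - ∏ i ∈ s, b i)‖ := by ring_nf
      _ ≤ ‖a j - b j‖ * ‖∏ i ∈ s, a i‖ + ‖b j‖ * ‖∏ i ∈ s, a i - ∏ i ∈ s, b i‖ := by
          refine (norm_add_le _ _).trans ?_
          rw [norm_mul, norm_mul]
      _ ≤ ‖a j - b j‖ * 1 + 1 * ∑ i ∈ s, ‖a i - b i‖ := by gcongr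
      _ = _ := by ring

/-! ### Moments and characteristic functions of bounded variables; the independent case. -/

section Bounded

variable {Ω : Type*} [MeasurableSpace Ω] {P : Measure Ω}

theorem integrable_comp_of_ae_abs_le [IsFiniteMeasure P] {F : Type*} [NormedAddCommGroup F]
    {X : Ω → ℝ} {B : ℝ} (hX : AEMeasurable X P) (hB : ∀ᵐ ω ∂P, |X ω| ≤ B)
    {g : ℝ → F} (hg : Continuous g) : Integrable (fun ω => g (X ω)) P := by
  obtain ⟨R, hR⟩ := (isCompact_Icc (a := -B) (b := B)).exists_bound_of_continuousOn
    hg.continuousOn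
  exact Integrable.of_bound (hg.comp_aestronglyMeasurable hX.aestronglyMeasurable) R
    (hB.mono fun ω hω => hR _ (abs_le.1 hω))

/-- The characteristic function of a bounded random variable, compared with its moments. -/
theorem norm_integral_cexp_sub_taylor_le [IsProbabilityMeasure P] {X : Ω → ℝ} {B : ℝ}
    (hX : AEMeasurable X P) (hB : ∀ᵐ ω ∂P, |X ω| ≤ B) (t : ℝ) (n : ℕ) :
    ‖∫ ω, Complex.exp ((t * X ω : ℝ) * Complex.I) ∂P -
        ∑ k ∈ Finset.range n, (t * Complex.I) ^ k / (k.factorial : ℂ) *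
          ((∫ ω, X ω ^ k ∂P : ℝ) : ℂ)‖ ≤
      |t| ^ n / n.factorial * ∫ ω, |X ω| ^ n ∂P := by
  have hint : ∀ k ∈ Finset.range n, Integrable
      (fun ω => ((t * X ω : ℝ) * Complex.I) ^ k / (k.factorial : ℂ)) P := fun k _ =>
    integrable_comp_of_ae_abs_le hX hB
      (g := fun x => ((t * x : ℝ) * Complex.I) ^ k / (k.factorial : ℂ)) (by fun_prop)
  have hsum : ∑ k ∈ Finset.range n, (t * Complex.I) ^ k / (k.factorial : ℂ) *
          ((∫ ω, X ω ^ k ∂P : ℝ) : ℂ) =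
      ∫ ω, ∑ k ∈ Finset.range n, ((t * X ω : ℝ) * Complex.I) ^ k / (k.factorial : ℂ) ∂P := by
    rw [integral_finsetSum _ hint]
    refine Finset.sum_congr rfl fun k _ => ?_
    rw [← integral_complex_ofReal, ← integral_const_mul]
    congr 1
    ext ω
    push_cast
    ring
  rw [hsum, ← integral_sub (integrable_comp_of_ae_abs_le hX hB
    (g := fun x => Complex.exp ((t * x : ℝ) * Complex.I)) (by fun_prop))
    (integrable_finsetSum _ hint), ← integral_const_mul]
  refine norm_integral_le_of_norm_le (integrable_comp_of_ae_abs_le hX hB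
    (g := fun x => |t| ^ n / n.factorial * |x| ^ n) (by fun_prop)) (ae_of_all _ fun ω => ?_)
  refine (norm_cexp_sub_taylor_le n (t * X ω)).trans (le_of_eq ?_)
  rw [abs_mul, mul_pow]
  ring

/-- Bound for an even moment by exponential moments. -/
theorem integral_pow_le_of_integral_exp_le [IsProbabilityMeasure P] {X : Ω → ℝ} {B : ℝ}
    (hX : AEMeasurable X P) (hB : ∀ᵐ ω ∂P, |X ω| ≤ B) {s D : ℝ} (m : ℕ)
    (hpos : ∫ ω, Real.exp (s * X ω) ∂P ≤ D) (hneg : ∫ ω, Real.exp (-s * X ω) ∂P ≤ D) :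
    s ^ (2 * m) / (2 * m).factorial * ∫ ω, X ω ^ (2 * m) ∂P ≤ 2 * D := by
  have h1 := integrable_comp_of_ae_abs_le hX hB (g := fun x => Real.exp (s * x)) (by fun_prop)
  have h2 := integrable_comp_of_ae_abs_le hX hB (g := fun x => Real.exp (-s * x)) (by fun_prop)
  rw [← integral_const_mul]
  calc ∫ ω, s ^ (2 * m) / (2 * m).factorial * X ω ^ (2 * m) ∂P
      ≤ ∫ ω, (Real.exp (s * X ω) + Real.exp (-s * X ω)) ∂P := by
        refine integral_mono (integrable_comp_of_ae_abs_le hX hB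
          (g := fun x => s ^ (2 * m) / (2 * m).factorial * x ^ (2 * m)) (by fun_prop))
          (h1.add h2) fun ω => ?_
        -- Pointwise, `u ^ (2m) / (2m)! ≤ exp |u| ≤ exp u + exp (-u)` with `u = s * X ω`.
        have h3 : |s * X ω| ^ (2 * m) / (2 * m).factorial ≤ Real.exp |s * X ω| :=
          Real.pow_div_factorial_le_exp _ (abs_nonneg _) _
        have h4 : s ^ (2 * m) / (2 * m).factorial * X ω ^ (2 * m) =
            |s * X ω| ^ (2 * m) / (2 * m).factorial := by
          rw [(even_two_mul m).pow_abs, mul_pow]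
          ring
        refine (h4.trans_le h3).trans ?_
        rcases abs_choice (s * X ω) with h | h <;> rw [h]
        · have := Real.exp_pos (-s * X ω)
          linarith
        · have := Real.exp_pos (s * X ω)
          rw [neg_mul]
          linarith
    _ = ∫ ω, Real.exp (s * X ω) ∂P + ∫ ω, Real.exp (-s * X ω) ∂P := integral_add h1 h2
    _ ≤ _ := by linarith

/-- For `|u| ≤ 1` one has `exp u ≤ 1 + u + u²`, and the linear term integrates to zero. The sharp
constant `1/2` in the exponent is not needed. -/
theorem integral_exp_le_of_centered [IsProbabilityMeasure P] {X : Ω → ℝ} {B : ℝ}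
    (hX : AEMeasurable X P) (hB : ∀ᵐ ω ∂P, |X ω| ≤ B) (h0 : ∫ ω, X ω ∂P = 0)
    {s : ℝ} (hs : |s| * B ≤ 1) :
    ∫ ω, Real.exp (s * X ω) ∂P ≤ Real.exp (s ^ 2 * ∫ ω, X ω ^ 2 ∂P) := by
  have i1 := integrable_comp_of_ae_abs_le hX hB (g := fun x => 1 + s * x) (by fun_prop)
  have i2 := integrable_comp_of_ae_abs_le hX hB (g := fun x => s ^ 2 * x ^ 2) (by fun_prop)
  calc ∫ ω, Real.exp (s * X ω) ∂P ≤ ∫ ω, ((1 + s * X ω) + s ^ 2 * X ω ^ 2) ∂P := by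
        refine integral_mono_ae (integrable_comp_of_ae_abs_le hX hB
          (g := fun x => Real.exp (s * x)) (by fun_prop)) (i1.add i2) (hB.mono fun ω hω => ?_)
        have : |s * X ω| ≤ 1 := by
          rw [abs_mul]
          exact (mul_le_mul_of_nonneg_left hω (abs_nonneg s)).trans hs
        have := (abs_le.1 (Real.abs_exp_sub_one_sub_id_le this)).2
        simp only
        nlinarith
    _ = 1 + s ^ 2 * ∫ ω, X ω ^ 2 ∂P := by
        rw [integral_add i1 i2, integral_add (integrable_const _)
          (integrable_comp_of_ae_abs_le hX hB (g := fun x => s * x) (by fun_prop)),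
          integral_const_mul, integral_const_mul, h0]
        simp
    _ ≤ _ := by
        rw [add_comm]
        exact Real.add_one_le_exp _

/-- Both terms are compared with `1 - t²v/2`, where `v` is the variance: the first with a cubic
remainder, the Gaussian one with an error quadratic in `t²v`. The bounds `𝐄|X|³ ≤ B v` and `v ≤ B²`
make the total linear in `v`, so that it can be summed over independent variables. -/
theorem norm_integral_cexp_sub_exp_le_of_centered [IsProbabilityMeasure P] {X : Ω → ℝ} {B : ℝ}
    (hX : AEMeasurable X P) (hB : ∀ᵐ ω ∂P, |X ω| ≤ B) (h0 : ∫ ω, X ω ∂P = 0)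
    {t : ℝ} (ht : |t| * B ≤ 1) :
    ‖∫ ω, Complex.exp ((t * X ω : ℝ) * Complex.I) ∂P -
        (Real.exp (-(t ^ 2 * (∫ ω, X ω ^ 2 ∂P) / 2)) : ℝ)‖ ≤
      (|t| ^ 3 * B + t ^ 4 * B ^ 2) * ∫ ω, X ω ^ 2 ∂P := by
  have hB0 : 0 ≤ B := by
    obtain ⟨ω, hω⟩ := hB.exists
    exact (abs_nonneg _).trans hω
  set v := ∫ ω, X ω ^ 2 ∂P with hv
  have i2 := integrable_comp_of_ae_abs_le hX hB (g := fun x => x ^ 2) (by fun_prop)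
  have hv0 : 0 ≤ v := integral_nonneg fun ω => sq_nonneg _
  have hvB : v ≤ B ^ 2 := by
    have : v ≤ ∫ _, B ^ 2 ∂P := integral_mono_ae i2 (integrable_const _)
      (hB.mono fun ω hω => by simpa using pow_le_pow_left₀ (abs_nonneg _) hω 2)
    simpa using this
  have h3 : ∫ ω, |X ω| ^ 3 ∂P ≤ B * v := by
    rw [hv, ← integral_const_mul]
    refine integral_mono_ae (integrable_comp_of_ae_abs_le hX hB (g := fun x => |x| ^ 3)
      (by fun_prop)) (i2.const_mul B) (hB.mono fun ω hω => ?_)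
    simp only
    rw [← sq_abs (X ω), pow_succ' _ 2]
    gcongr
  have hT := norm_integral_cexp_sub_taylor_le hX hB t 3
  have hsum : ∑ k ∈ Finset.range 3, (t * Complex.I) ^ k / (k.factorial : ℂ) *
      ((∫ ω, X ω ^ k ∂P : ℝ) : ℂ) = ((1 - t ^ 2 * v / 2 : ℝ) : ℂ) := by
    simp [Finset.sum_range_succ, h0, mul_pow, ← hv, Nat.factorial]
    ring
  rw [hsum] at hT
  have hu : |-(t ^ 2 * v / 2)| ≤ 1 := by
    have : t ^ 2 * v ≤ 1 := by
      calc t ^ 2 * v ≤ t ^ 2 * B ^ 2 := by gcongr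
        _ = (|t| * B) ^ 2 := by rw [mul_pow, sq_abs]
        _ ≤ 1 := pow_le_one₀ (by positivity) ht
    rw [abs_neg, abs_of_nonneg (by positivity)]
    linarith
  have hE := Real.abs_exp_sub_one_sub_id_le hu
  have hE' : ‖((1 - t ^ 2 * v / 2 : ℝ) : ℂ) - (Real.exp (-(t ^ 2 * v / 2)) : ℝ)‖ ≤
      t ^ 4 * B ^ 2 * v := by
    rw [← Complex.ofReal_sub, Complex.norm_real, Real.norm_eq_abs, abs_sub_comm]
    calc |Real.exp (-(t ^ 2 * v / 2)) - (1 - t ^ 2 * v / 2)|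
        = |Real.exp (-(t ^ 2 * v / 2)) - 1 - -(t ^ 2 * v / 2)| := by ring_nf
      _ ≤ (-(t ^ 2 * v / 2)) ^ 2 := hE
      _ = t ^ 4 * (v / 4) * v := by ring
      _ ≤ t ^ 4 * B ^ 2 * v := by
        gcongr
        linarith
  refine (norm_sub_le_norm_sub_add_norm_sub _ ((1 - t ^ 2 * v / 2 : ℝ) : ℂ) _).trans ?_
  have : |t| ^ 3 / (3 : ℕ).factorial * ∫ ω, |X ω| ^ 3 ∂P ≤ |t| ^ 3 * (B * v) := by
    gcongr
    exact div_le_self (by positivity) (by norm_num [Nat.factorial])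
  calc _ ≤ |t| ^ 3 * (B * v) + t ^ 4 * B ^ 2 * v := add_le_add (hT.trans this) hE'
    _ = _ := by ring

variable {ι : Type*} [Fintype ι] {X : ι → Ω → ℝ} {B : ℝ}

theorem integral_exp_sum_le_of_centered (hind : iIndepFun X P)
    (hX : ∀ i, AEMeasurable (X i) P) (hB : ∀ i, ∀ᵐ ω ∂P, |X i ω| ≤ B)
    (h0 : ∀ i, ∫ ω, X i ω ∂P = 0) {s : ℝ} (hs : |s| * B ≤ 1) :
    ∫ ω, Real.exp (s * ∑ i, X i ω) ∂P ≤ Real.exp (s ^ 2 * ∑ i, ∫ ω, X i ω ^ 2 ∂P) := by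
  have := hind.isProbabilityMeasure
  calc ∫ ω, Real.exp (s * ∑ i, X i ω) ∂P = ∫ ω, ∏ i, Real.exp (s * X i ω) ∂P := by
        simp_rw [Finset.mul_sum, Real.exp_sum]
    _ = ∏ i, ∫ ω, Real.exp (s * X i ω) ∂P :=
        hind.integral_fun_prod_comp (f := fun _ x => Real.exp (s * x)) hX fun i =>
          (by fun_prop : Continuous fun x : ℝ => Real.exp (s * x)).aestronglyMeasurable
    _ ≤ ∏ i, Real.exp (s ^ 2 * ∫ ω, X i ω ^ 2 ∂P) :=
        Finset.prod_le_prod (fun i _ => integral_nonneg fun _ => (Real.exp_pos _).le)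
          fun i _ => integral_exp_le_of_centered (hX i) (hB i) (h0 i) hs
    _ = _ := by rw [Finset.mul_sum, Real.exp_sum]

/-- Quantitative central limit theorem for sums of bounded independent random variables. -/
theorem norm_integral_cexp_sum_sub_exp_le (hind : iIndepFun X P)
    (hX : ∀ i, AEMeasurable (X i) P) (hB : ∀ i, ∀ᵐ ω ∂P, |X i ω| ≤ B)
    (h0 : ∀ i, ∫ ω, X i ω ∂P = 0) {t : ℝ} (ht : |t| * B ≤ 1) :
    ‖∫ ω, Complex.exp ((t * ∑ i, X i ω : ℝ) * Complex.I) ∂P -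
        (Real.exp (-(t ^ 2 * (∑ i, ∫ ω, X i ω ^ 2 ∂P) / 2)) : ℝ)‖ ≤
      (|t| ^ 3 * B + t ^ 4 * B ^ 2) * ∑ i, ∫ ω, X i ω ^ 2 ∂P := by
  have := hind.isProbabilityMeasure
  have h1 : ∫ ω, Complex.exp ((t * ∑ i, X i ω : ℝ) * Complex.I) ∂P =
      ∏ i, ∫ ω, Complex.exp ((t * X i ω : ℝ) * Complex.I) ∂P := by
    rw [← hind.integral_fun_prod_comp
      (f := fun _ x => Complex.exp ((t * x : ℝ) * Complex.I)) hX fun i =>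
        (by fun_prop : Continuous fun x : ℝ =>
          Complex.exp ((t * x : ℝ) * Complex.I)).aestronglyMeasurable]
    simp_rw [Finset.mul_sum, Complex.ofReal_sum, Finset.sum_mul, Complex.exp_sum]
  have h2 : ((Real.exp (-(t ^ 2 * (∑ i, ∫ ω, X i ω ^ 2 ∂P) / 2)) : ℝ) : ℂ) =
      ∏ i, ((Real.exp (-(t ^ 2 * (∫ ω, X i ω ^ 2 ∂P) / 2)) : ℝ) : ℂ) := by
    rw [← Complex.ofReal_prod, ← Real.exp_sum, Finset.sum_neg_distrib, Finset.mul_sum,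
      Finset.sum_div]
  rw [h1, h2, Finset.mul_sum]
  refine (norm_prod_sub_prod_le_sum _ (fun i _ => ?_) (fun i _ => ?_)).trans
    (Finset.sum_le_sum fun i _ =>
      norm_integral_cexp_sub_exp_le_of_centered (hX i) (hB i) (h0 i) ht)
  · refine (norm_integral_le_of_norm_le_const (C := 1) (ae_of_all _ fun ω => ?_)).trans (by simp)
    rw [Complex.norm_exp_ofReal_mul_I]
  · rw [Complex.norm_real, Real.norm_eq_abs, abs_of_pos (Real.exp_pos _), Real.exp_le_one_iff]
    have : 0 ≤ ∫ ω, X i ω ^ 2 ∂P := integral_nonneg fun ω => sq_nonneg _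
    have : 0 ≤ t ^ 2 * ∫ ω, X i ω ^ 2 ∂P := by positivity
    linarith

end Bounded

/-! ### Comparing moments of two families through probabilities of nonzero values. -/

/-- The nonzero integers of absolute value at most `C`. -/
noncomputable def nonzeroIntegersUpTo (C : ℝ) : Finset ℤ := (Finset.Icc (-⌊C⌋) ⌊C⌋).erase 0

theorem mem_nonzeroIntegersUpTo {C : ℝ} {z : ℤ} :
    z ∈ nonzeroIntegersUpTo C ↔ z ≠ 0 ∧ |(z : ℝ)| ≤ C := by
  rw [nonzeroIntegersUpTo, Finset.mem_erase, Finset.mem_Icc, ← abs_le, Int.le_floor, Int.cast_abs]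

theorem card_nonzeroIntegersUpTo_le {C : ℝ} (hC : 0 ≤ C) :
    ((nonzeroIntegersUpTo C).card : ℝ) ≤ 2 * C := by
  have h0 : (0 : ℤ) ∈ Finset.Icc (-⌊C⌋) ⌊C⌋ := by
    have := Int.floor_nonneg.2 hC
    rw [Finset.mem_Icc]
    omega
  have h1 : ((nonzeroIntegersUpTo C).card : ℤ) = 2 * ⌊C⌋ := by
    have := Int.floor_nonneg.2 hC
    rw [nonzeroIntegersUpTo, Finset.card_erase_of_mem h0, Int.card_Icc]
    omega
  have h2 : ((nonzeroIntegersUpTo C).card : ℝ) = 2 * (⌊C⌋ : ℝ) := by exact_mod_cast h1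
  rw [h2]
  linarith [Int.floor_le C]

/-- A positive power vanishes at `0`, so the value `0`, about which the sieve hypothesis is silent,
never enters. -/
theorem intCast_pow_eq_sum {C : ℝ} {z : ℤ} (hz : |(z : ℝ)| ≤ C) {m : ℕ} (hm : m ≠ 0) :
    (z : ℝ) ^ m = ∑ l ∈ nonzeroIntegersUpTo C, if z = l then (l : ℝ) ^ m else 0 := by
  rw [Finset.sum_ite_eq]
  split_ifs with h
  · rfl
  · have : z = 0 := by
      by_contra h0
      exact h (mem_nonzeroIntegersUpTo.2 ⟨h0, hz⟩)
    simp [this, hm]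

section Compare

variable {ι : Type*}

theorem integral_prod_pow_eq_sum [DecidableEq ι] {Ω : Type*} [MeasurableSpace Ω] {P : Measure Ω}
    [IsProbabilityMeasure P] {C : ℝ} {z : ι → Ω → ℤ} (hz : ∀ i, Measurable (z i))
    (hzC : ∀ i, ∀ᵐ ω ∂P, |(z i ω : ℝ)| ≤ C) (T : Finset ι) {m : ι → ℕ}
    (hm : ∀ i ∈ T, m i ≠ 0) :
    ∫ ω, ∏ i ∈ T, (z i ω : ℝ) ^ m i ∂P =
      ∑ l ∈ Fintype.piFinset fun _ : T => nonzeroIntegersUpTo C,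
        (∏ i : T, (l i : ℝ) ^ m i) * P.real {ω | ∀ i : T, z i ω = l i} := by
  classical
  have hmeas : ∀ l : T → ℤ, MeasurableSet {ω | ∀ i : T, z i ω = l i} := fun l => by
    rw [Set.ofPred_forall]
    exact MeasurableSet.iInter fun i => hz i (measurableSet_singleton (l i))
  have hT : ∀ᵐ ω ∂P, ∀ i : T, |(z i ω : ℝ)| ≤ C := ae_all_iff.2 fun i => hzC i
  have key : ∀ᵐ ω ∂P, ∏ i ∈ T, (z i ω : ℝ) ^ m i =
      ∑ l ∈ Fintype.piFinset fun _ : T => nonzeroIntegersUpTo C,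
        (∏ i : T, (l i : ℝ) ^ m i) * {ω | ∀ i : T, z i ω = l i}.indicator 1 ω := by
    filter_upwards [hT] with ω hω
    rw [← Finset.prod_coe_sort T]
    simp_rw [fun i : T => intCast_pow_eq_sum (hω i) (hm i i.2)]
    rw [Finset.prod_univ_sum]
    refine Finset.sum_congr rfl fun l _ => ?_
    by_cases h : ∀ i : T, z i ω = l i
    · rw [Set.indicator_of_mem (by exact h)]
      simp [h]
    · rw [Set.indicator_of_notMem (by exact h), mul_zero]
      push Not at h
      obtain ⟨i, hi⟩ := h
      exact Finset.prod_eq_zero (Finset.mem_univ i) (if_neg hi)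
  rw [integral_congr_ae key, integral_finsetSum]
  · refine Finset.sum_congr rfl fun l _ => ?_
    rw [integral_const_mul, integral_indicator_one (hmeas l)]
  · intro l _
    exact ((integrable_const (1 : ℝ)).indicator (hmeas l)).const_mul _

theorem setOf_forall_mem_eq_dite [DecidableEq ι] {Ω β : Type*} (w : ι → Ω → β) (T : Finset ι)
    (l : T → β) (b : β) :
    {ω | ∀ i ∈ T, w i ω = if hi : i ∈ T then l ⟨i, hi⟩ else b} = {ω | ∀ i : T, w i ω = l i} := by
  ext ω
  simp only [Set.mem_ofPred_eq, Subtype.forall]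
  refine forall_congr' fun i => forall_congr' fun hi => ?_
  rw [dif_pos hi]

variable {Ω₁ Ω₂ : Type*} [MeasurableSpace Ω₁] [MeasurableSpace Ω₂] {ν : Measure Ω₁}
  {P : Measure Ω₂} [IsProbabilityMeasure ν] [IsProbabilityMeasure P] {C : ℝ}
  {y : ι → Ω₁ → ℤ} {z : ι → Ω₂ → ℤ} {k : ℕ} {ε : ℝ}

/-- There are at most `(2C) ^ k` tuples of nonzero values, each weighted by a monomial of size at
most `C ^ k`. -/
theorem abs_integral_prod_pow_sub_le (hC : 1 ≤ C)
    (hy : ∀ i, Measurable (y i)) (hz : ∀ i, Measurable (z i))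
    (hyC : ∀ i, ∀ᵐ ω ∂ν, |(y i ω : ℝ)| ≤ C) (hzC : ∀ i, ∀ᵐ ω ∂P, |(z i ω : ℝ)| ≤ C)
    (T : Finset ι) {m : ι → ℕ} (hm : ∀ i ∈ T, m i ≠ 0) (hk : ∑ i ∈ T, m i = k) (hε : 0 ≤ ε)
    (h : ∀ l : ι → ℤ, (∀ i, l i ≠ 0) →
      |ν.real {ω | ∀ i ∈ T, y i ω = l i} - P.real {ω | ∀ i ∈ T, z i ω = l i}| ≤ ε) :
    |∫ ω, ∏ i ∈ T, (y i ω : ℝ) ^ m i ∂ν - ∫ ω, ∏ i ∈ T, (z i ω : ℝ) ^ m i ∂P| ≤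
      (2 * C ^ 2) ^ k * ε := by
  classical
  have hTk : T.card ≤ k := by
    rw [← hk, Finset.card_eq_sum_ones]
    exact Finset.sum_le_sum fun i hi => Nat.one_le_iff_ne_zero.2 (hm i hi)
  rw [integral_prod_pow_eq_sum hy hyC T hm, integral_prod_pow_eq_sum hz hzC T hm,
    ← Finset.sum_sub_distrib]
  calc _ ≤ ∑ l ∈ Fintype.piFinset fun _ : T => nonzeroIntegersUpTo C, C ^ k * ε := by
        refine (Finset.abs_sum_le_sum_abs _ _).trans (Finset.sum_le_sum fun l hl => ?_)
        rw [Fintype.mem_piFinset] at hl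
        rw [← mul_sub, abs_mul]
        have h1 : |∏ i : T, (l i : ℝ) ^ m i| ≤ C ^ k := by
          rw [Finset.abs_prod, ← hk, ← Finset.prod_pow_eq_pow_sum, ← Finset.prod_coe_sort T]
          refine Finset.prod_le_prod (fun _ _ => abs_nonneg _) fun i _ => ?_
          rw [abs_pow]
          exact pow_le_pow_left₀ (abs_nonneg _) (mem_nonzeroIntegersUpTo.1 (hl i)).2 _
        -- The value `1` outside `T` is arbitrary; it only has to be nonzero.
        have h2 := h (fun i => if hi : i ∈ T then l ⟨i, hi⟩ else 1) fun i => by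
          split_ifs with hi
          · exact (mem_nonzeroIntegersUpTo.1 (hl ⟨i, hi⟩)).1
          · exact one_ne_zero
        rw [setOf_forall_mem_eq_dite, setOf_forall_mem_eq_dite] at h2
        exact mul_le_mul h1 h2 (abs_nonneg _) (by positivity)
    _ = ((nonzeroIntegersUpTo C).card : ℝ) ^ T.card * (C ^ k * ε) := by
        simp
    _ ≤ (2 * C) ^ k * (C ^ k * ε) := by
        gcongr
        refine (pow_le_pow_left₀ (by positivity) (card_nonzeroIntegersUpTo_le (by linarith)) _).trans
          (pow_le_pow_right₀ (by linarith) hTk)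
    _ = (2 * C ^ 2) ^ k * ε := by
        rw [← mul_assoc, ← mul_pow]
        ring_nf

variable [Fintype ι]

theorem abs_intCast_sum_le {w : ι → ℤ} (hw : ∀ i, |(w i : ℝ)| ≤ C) :
    |∑ i, (w i : ℝ)| ≤ Fintype.card ι * C := by
  refine (Finset.abs_sum_le_sum_abs _ _).trans ((Finset.sum_le_sum fun i _ => hw i).trans ?_)
  simp

/-- Grouping equal factors by the fibres of `g` leaves only positive exponents, as the comparison of
monomials requires. -/
theorem integral_sum_pow_eq_sum {Ω : Type*} [MeasurableSpace Ω] {P : Measure Ω}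
    [IsProbabilityMeasure P] [DecidableEq ι] {z : ι → Ω → ℤ} (hz : ∀ i, Measurable (z i))
    (hzC : ∀ i, ∀ᵐ ω ∂P, |(z i ω : ℝ)| ≤ C) (k : ℕ) :
    ∫ ω, (∑ i, (z i ω : ℝ)) ^ k ∂P = ∑ g : Fin k → ι,
      ∫ ω, ∏ i ∈ Finset.univ.image g,
        (z i ω : ℝ) ^ (Finset.univ.filter fun a => g a = i).card ∂P := by
  have hall : ∀ᵐ ω ∂P, ∀ i, |(z i ω : ℝ)| ≤ C := ae_all_iff.2 hzC
  rw [← integral_finsetSum]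
  · congr 1
    ext ω
    rw [Finset.sum_pow', Fintype.piFinset_univ]
    refine Finset.sum_congr rfl fun g _ => ?_
    exact Finset.prod_comp (fun i => (z i ω : ℝ)) g
  · intro g _
    refine Integrable.of_bound (C := ∏ i ∈ Finset.univ.image g,
      C ^ (Finset.univ.filter fun a => g a = i).card) ?_ (hall.mono fun ω hω => ?_)
    · refine Measurable.aestronglyMeasurable ?_
      refine Finset.measurable_fun_prod _ fun i _ => ?_
      exact (measurable_from_top.comp (hz i)).pow_const _
    · rw [Real.norm_eq_abs, Finset.abs_prod]
      refine Finset.prod_le_prod (fun _ _ => abs_nonneg _) fun i _ => ?_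
      rw [abs_pow]
      exact pow_le_pow_left₀ (abs_nonneg _) (hω i) _

theorem abs_integral_sum_pow_sub_le (hC : 1 ≤ C)
    (hy : ∀ i, Measurable (y i)) (hz : ∀ i, Measurable (z i))
    (hyC : ∀ i, ∀ᵐ ω ∂ν, |(y i ω : ℝ)| ≤ C) (hzC : ∀ i, ∀ᵐ ω ∂P, |(z i ω : ℝ)| ≤ C)
    (hε : 0 ≤ ε)
    (h : ∀ T : Finset ι, T.card ≤ k → ∀ l : ι → ℤ, (∀ i, l i ≠ 0) →
      |ν.real {ω | ∀ i ∈ T, y i ω = l i} - P.real {ω | ∀ i ∈ T, z i ω = l i}| ≤ ε) :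
    |∫ ω, (∑ i, (y i ω : ℝ)) ^ k ∂ν - ∫ ω, (∑ i, (z i ω : ℝ)) ^ k ∂P| ≤
      (Fintype.card ι * (2 * C ^ 2)) ^ k * ε := by
  classical
  rw [integral_sum_pow_eq_sum hy hyC, integral_sum_pow_eq_sum hz hzC, ← Finset.sum_sub_distrib]
  calc _ ≤ ∑ g : Fin k → ι, (2 * C ^ 2) ^ k * ε := by
        refine (Finset.abs_sum_le_sum_abs _ _).trans (Finset.sum_le_sum fun g _ => ?_)
        refine abs_integral_prod_pow_sub_le hC hy hz hyC hzC _ (fun i hi => ?_) ?_ hε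
          (h _ (Finset.card_image_le.trans (by simp)))
        · obtain ⟨a, -, rfl⟩ := Finset.mem_image.1 hi
          exact Finset.card_ne_zero_of_mem (Finset.mem_filter.2 ⟨Finset.mem_univ a, rfl⟩)
        · rw [← Finset.card_eq_sum_card_image]
          simp
    _ = _ := by
        rw [Finset.sum_const, Finset.card_univ, Fintype.card_fun, Fintype.card_fin, nsmul_eq_mul,
          mul_pow (Fintype.card ι : ℝ), mul_assoc]
        push_cast
        rfl

theorem integral_sub_pow_eq_sum {Ω : Type*} [MeasurableSpace Ω] {P : Measure Ω}
    [IsProbabilityMeasure P] {X : Ω → ℝ} {B : ℝ} (hX : AEMeasurable X P)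
    (hB : ∀ᵐ ω ∂P, |X ω| ≤ B) (M : ℝ) (k : ℕ) :
    ∫ ω, (X ω - M) ^ k ∂P =
      ∑ j ∈ Finset.range (k + 1), (-M) ^ (k - j) * (k.choose j) * ∫ ω, X ω ^ j ∂P := by
  simp_rw [← integral_const_mul]
  rw [← integral_finsetSum]
  · congr 1
    ext ω
    rw [sub_eq_add_neg, add_pow]
    refine Finset.sum_congr rfl fun j _ => ?_
    ring
  · intro j _
    exact integrable_comp_of_ae_abs_le hX hB
      (g := fun x => (-M) ^ (k - j) * (k.choose j) * x ^ j) (by fun_prop)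

/-- Comparison of moments of sums of integer-valued random variables, two families of which have
nearly the same joint distribution of few nonzero values. -/
theorem abs_integral_sum_sub_pow_sub_le (hC : 1 ≤ C)
    (hy : ∀ i, Measurable (y i)) (hz : ∀ i, Measurable (z i))
    (hyC : ∀ i, ∀ᵐ ω ∂ν, |(y i ω : ℝ)| ≤ C) (hzC : ∀ i, ∀ᵐ ω ∂P, |(z i ω : ℝ)| ≤ C)
    (hε : 0 ≤ ε)
    (h : ∀ T : Finset ι, T.card ≤ k → ∀ l : ι → ℤ, (∀ i, l i ≠ 0) →
      |ν.real {ω | ∀ i ∈ T, y i ω = l i} - P.real {ω | ∀ i ∈ T, z i ω = l i}| ≤ ε) (M : ℝ) :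
    |∫ ω, (∑ i, (y i ω : ℝ) - M) ^ k ∂ν - ∫ ω, (∑ i, (z i ω : ℝ) - M) ^ k ∂P| ≤
      (Fintype.card ι * (2 * C ^ 2) + |M|) ^ k * ε := by
  have hyS : Measurable fun ω => ∑ i, (y i ω : ℝ) :=
    Finset.measurable_fun_sum _ fun i _ => measurable_from_top.comp (hy i)
  have hzS : Measurable fun ω => ∑ i, (z i ω : ℝ) :=
    Finset.measurable_fun_sum _ fun i _ => measurable_from_top.comp (hz i)
  -- `add_pow` expands the bound on the right, so that it matches the expansions of the two moments
  -- term by term.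
  rw [integral_sub_pow_eq_sum hyS.aemeasurable
      ((ae_all_iff.2 hyC).mono fun ω hω => abs_intCast_sum_le hω),
    integral_sub_pow_eq_sum hzS.aemeasurable
      ((ae_all_iff.2 hzC).mono fun ω hω => abs_intCast_sum_le hω), ← Finset.sum_sub_distrib,
    add_pow, Finset.sum_mul]
  refine (Finset.abs_sum_le_sum_abs _ _).trans (Finset.sum_le_sum fun j hj => ?_)
  have hjk : j ≤ k := Nat.lt_succ_iff.1 (Finset.mem_range.1 hj)
  have hmom := abs_integral_sum_pow_sub_le hC hy hz hyC hzC hε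
    fun T hT => h T (hT.trans hjk)
  rw [← mul_sub, abs_mul, abs_mul, abs_pow, abs_neg, Nat.abs_cast]
  calc |M| ^ (k - j) * (k.choose j) * _
      ≤ |M| ^ (k - j) * (k.choose j) * ((Fintype.card ι * (2 * C ^ 2)) ^ j * ε) := by gcongr
    _ = _ := by ring

end Compare

/-! ### From close moments to close characteristic functions. -/

section Quantitative

variable {Ω₁ Ω₂ : Type*} [MeasurableSpace Ω₁] [MeasurableSpace Ω₂] {ν : Measure Ω₁}
  {P : Measure Ω₂} [IsProbabilityMeasure ν] [IsProbabilityMeasure P]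

/-- Both Taylor series are cut at degree `2m`. The order being even, the remainder for `X` involves
a plain moment, which is within `δ` of that of `Z`; hence the factor `2`, and no separate tail bound
for `X`. -/
theorem norm_integral_cexp_sub_integral_cexp_le {X : Ω₁ → ℝ} {Z : Ω₂ → ℝ} {B B' : ℝ}
    (hX : AEMeasurable X ν) (hB : ∀ᵐ ω ∂ν, |X ω| ≤ B)
    (hZ : AEMeasurable Z P) (hB' : ∀ᵐ ω ∂P, |Z ω| ≤ B') {m : ℕ} {δ : ℝ}
    (hδ : ∀ k ≤ 2 * m, |∫ ω, X ω ^ k ∂ν - ∫ ω, Z ω ^ k ∂P| ≤ δ) (t : ℝ) :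
    ‖∫ ω, Complex.exp ((t * X ω : ℝ) * Complex.I) ∂ν -
        ∫ ω, Complex.exp ((t * Z ω : ℝ) * Complex.I) ∂P‖ ≤
      Real.exp |t| * δ + 2 * (|t| ^ (2 * m) / (2 * m).factorial * ∫ ω, Z ω ^ (2 * m) ∂P) := by
  have hδ0 : 0 ≤ δ := (abs_nonneg _).trans (hδ 0 (Nat.zero_le _))
  have h1 := norm_integral_cexp_sub_taylor_le hX hB t (2 * m)
  have h2 := norm_integral_cexp_sub_taylor_le hZ hB' t (2 * m)
  simp_rw [(even_two_mul m).pow_abs] at h1 h2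
  set S₁ := ∑ k ∈ Finset.range (2 * m), (t * Complex.I) ^ k / (k.factorial : ℂ) *
    ((∫ ω, X ω ^ k ∂ν : ℝ) : ℂ)
  set S₂ := ∑ k ∈ Finset.range (2 * m), (t * Complex.I) ^ k / (k.factorial : ℂ) *
    ((∫ ω, Z ω ^ k ∂P : ℝ) : ℂ)
  have h3 : ‖S₁ - S₂‖ ≤ ∑ k ∈ Finset.range (2 * m), |t| ^ k / k.factorial * δ := by
    rw [← Finset.sum_sub_distrib]
    refine (norm_sum_le _ _).trans (Finset.sum_le_sum fun k hk => ?_)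
    rw [← mul_sub, norm_mul, ← Complex.ofReal_sub, Complex.norm_real, Real.norm_eq_abs]
    have : ‖(t * Complex.I) ^ k / (k.factorial : ℂ)‖ = |t| ^ k / k.factorial := by
      simp
    rw [this]
    gcongr
    exact hδ k (Finset.mem_range.1 hk).le
  have h4 : ∫ ω, X ω ^ (2 * m) ∂ν ≤ ∫ ω, Z ω ^ (2 * m) ∂P + δ := by
    linarith [(abs_le.1 (hδ _ le_rfl)).2]
  -- All contributions of `δ`, including the one from the remainder of `X`, form a partial sum of
  -- `exp |t|`.
  have h5 : ∑ k ∈ Finset.range (2 * m), |t| ^ k / k.factorial * δ +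
      t ^ (2 * m) / (2 * m).factorial * δ ≤ Real.exp |t| * δ := by
    rw [← (even_two_mul m).pow_abs t, ← Finset.sum_range_succ (fun k => |t| ^ k / k.factorial * δ),
      ← Finset.sum_mul]
    gcongr
    exact Real.sum_le_exp_of_nonneg (abs_nonneg t) _
  have h6 : t ^ (2 * m) / (2 * m).factorial * ∫ ω, X ω ^ (2 * m) ∂ν ≤
      t ^ (2 * m) / (2 * m).factorial * (∫ ω, Z ω ^ (2 * m) ∂P + δ) := by
    refine mul_le_mul_of_nonneg_left h4 ?_
    rw [← (even_two_mul m).pow_abs t]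
    positivity
  rw [norm_sub_rev] at h2
  rw [(even_two_mul m).pow_abs t]
  rw [← dist_eq_norm] at *
  have h7 := dist_triangle4 (∫ ω, Complex.exp ((t * X ω : ℝ) * Complex.I) ∂ν) S₁ S₂
    (∫ ω, Complex.exp ((t * Z ω : ℝ) * Complex.I) ∂P)
  linarith

theorem abs_integral_le_of_ae_abs_le {X : Ω₂ → ℝ} {C : ℝ} (hC : ∀ᵐ ω ∂P, |X ω| ≤ C) :
    |∫ ω, X ω ∂P| ≤ C := by
  have hC' : ∀ᵐ ω ∂P, ‖X ω‖ ≤ C := hC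
  simpa using norm_integral_le_of_norm_le_const hC'

variable {ι : Type*} [Fintype ι] {y : ι → Ω₁ → ℤ} {z : ι → Ω₂ → ℤ} {C ε σ : ℝ} {m : ℕ}

/-- Quantitative central limit theorem for a family of integer-valued random variables whose joint
distribution is close to that of an independent family. -/
theorem norm_integral_cexp_normalized_sum_sub_exp_le (hC : 1 ≤ C) (hind : iIndepFun z P)
    (hy : ∀ i, Measurable (y i)) (hz : ∀ i, Measurable (z i))
    (hyC : ∀ i, ∀ᵐ ω ∂ν, |(y i ω : ℝ)| ≤ C) (hzC : ∀ i, ∀ᵐ ω ∂P, |(z i ω : ℝ)| ≤ C)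
    (hε : 0 ≤ ε)
    (h : ∀ T : Finset ι, T.card ≤ 2 * m → ∀ l : ι → ℤ, (∀ i, l i ≠ 0) →
      |ν.real {ω | ∀ i ∈ T, y i ω = l i} - P.real {ω | ∀ i ∈ T, z i ω = l i}| ≤ ε)
    (hσ1 : 1 ≤ σ)
    (hσ : ∑ i, ∫ ω, ((z i ω : ℝ) - ∫ ω', (z i ω' : ℝ) ∂P) ^ 2 ∂P = σ ^ 2) {t : ℝ}
    (ht : (2 * |t| + 1) * (2 * C / σ) ≤ 1) :
    ‖∫ ω, Complex.exp ((t * ((∑ i, (y i ω : ℝ) - ∑ i, ∫ ω', (z i ω' : ℝ) ∂P) / σ) : ℝ) *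
        Complex.I) ∂ν - (Real.exp (-(t ^ 2 / 2)) : ℝ)‖ ≤
      Real.exp |t| * ((Fintype.card ι * (3 * C ^ 2) + 1) ^ (2 * m) * ε) +
        4 * ((1 / 4) ^ m * Real.exp ((2 * |t| + 1) ^ 2)) +
        (|t| ^ 3 * (2 * C / σ) + t ^ 4 * (2 * C / σ) ^ 2) := by
  have hσ0 : 0 < σ := by linarith
  set M := ∑ i, ∫ ω', (z i ω' : ℝ) ∂P with hM
  set X : Ω₁ → ℝ := fun ω => (∑ i, (y i ω : ℝ) - M) / σ with hX_def
  set Z : Ω₂ → ℝ := fun ω => (∑ i, (z i ω : ℝ) - M) / σ with hZ_def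
  set W : ι → Ω₂ → ℝ := fun i ω => ((z i ω : ℝ) - ∫ ω', (z i ω' : ℝ) ∂P) / σ with hW_def
  have hmean : ∀ i, |∫ ω', (z i ω' : ℝ) ∂P| ≤ C := fun i => abs_integral_le_of_ae_abs_le (hzC i)
  have hMC : |M| ≤ Fintype.card ι * C := by
    refine (Finset.abs_sum_le_sum_abs _ _).trans
      ((Finset.sum_le_sum fun i _ => hmean i).trans ?_)
    simp
  have hX : AEMeasurable X ν := (((Finset.measurable_fun_sum _ fun i _ =>
    measurable_from_top.comp (hy i)).sub_const M).div_const σ).aemeasurable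
  have hZ : AEMeasurable Z P := (((Finset.measurable_fun_sum _ fun i _ =>
    measurable_from_top.comp (hz i)).sub_const M).div_const σ).aemeasurable
  have hW : ∀ i, AEMeasurable (W i) P := fun i =>
    (((measurable_from_top.comp (hz i)).sub_const _).div_const σ).aemeasurable
  have hbound : ∀ {w : ι → ℤ}, (∀ i, |(w i : ℝ)| ≤ C) →
      |(∑ i, (w i : ℝ) - M) / σ| ≤ (Fintype.card ι * C + |M|) / σ := fun {w} hw => by
    rw [abs_div, abs_of_pos hσ0]
    gcongr
    exact (abs_sub _ _).trans (add_le_add_left (abs_intCast_sum_le hw) _)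
  have hXB : ∀ᵐ ω ∂ν, |X ω| ≤ (Fintype.card ι * C + |M|) / σ :=
    (ae_all_iff.2 hyC).mono fun ω hω => hbound hω
  have hZB : ∀ᵐ ω ∂P, |Z ω| ≤ (Fintype.card ι * C + |M|) / σ :=
    (ae_all_iff.2 hzC).mono fun ω hω => hbound hω
  have hWB : ∀ i, ∀ᵐ ω ∂P, |W i ω| ≤ 2 * C / σ := fun i => (hzC i).mono fun ω hω => by
    rw [hW_def]
    simp only
    rw [abs_div, abs_of_pos hσ0]
    gcongr
    exact (abs_sub _ _).trans (by linarith [hmean i])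
  have hint : ∀ i, Integrable (fun ω => (z i ω : ℝ)) P := fun i =>
    integrable_comp_of_ae_abs_le (measurable_from_top.comp (hz i)).aemeasurable (hzC i)
      continuous_id
  have hW0 : ∀ i, ∫ ω, W i ω ∂P = 0 := fun i => by
    rw [hW_def]
    simp only
    rw [integral_div, integral_sub (hint i) (integrable_const _)]
    simp
  have hWind : iIndepFun W P :=
    hind.comp (fun i (n : ℤ) => ((n : ℝ) - ∫ ω', (z i ω' : ℝ) ∂P) / σ)
      fun _ => measurable_from_top
  have hWV : ∑ i, ∫ ω, W i ω ^ 2 ∂P = 1 := by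
    simp_rw [hW_def, div_pow, integral_div, ← Finset.sum_div, hσ]
    exact div_self (by positivity)
  have hZW : ∀ ω, ∑ i, W i ω = Z ω := fun ω => by
    simp only [hW_def, hZ_def, hM, ← Finset.sum_div, Finset.sum_sub_distrib]
  have hb0 : 0 ≤ 2 * C / σ := by positivity
  have htb : |t| * (2 * C / σ) ≤ 1 := by
    refine le_trans ?_ ht
    gcongr
    linarith [abs_nonneg t]
  have hclt := norm_integral_cexp_sum_sub_exp_le hWind hW hWB hW0 htb
  simp_rw [hZW, hWV, mul_one] at hclt
  -- The exponential moments are taken at `s = 2|t| + 1`; as `s ≥ 2|t|`, the factor `(t / s) ^ (2m)`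
  -- is at most `4 ^ (-m)`.
  have hs : |2 * |t| + 1| * (2 * C / σ) ≤ 1 := by rwa [abs_of_nonneg (by positivity)]
  have hexp := integral_exp_sum_le_of_centered hWind hW hWB hW0 hs
  have hexp' := integral_exp_sum_le_of_centered hWind hW hWB hW0 (s := -(2 * |t| + 1))
    (by rwa [abs_neg])
  simp_rw [hZW, hWV, mul_one] at hexp hexp'
  rw [neg_sq] at hexp'
  have hmom := integral_pow_le_of_integral_exp_le hZ hZB m hexp hexp'
  have hδ : ∀ k ≤ 2 * m, |∫ ω, X ω ^ k ∂ν - ∫ ω, Z ω ^ k ∂P| ≤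
      (Fintype.card ι * (3 * C ^ 2) + 1) ^ (2 * m) * ε := fun k hk => by
    have h1 := abs_integral_sum_sub_pow_sub_le hC hy hz hyC hzC hε
      (fun T hT => h T (hT.trans hk)) M
    simp_rw [hX_def, hZ_def, div_pow, integral_div, ← sub_div]
    rw [abs_div, abs_of_pos (pow_pos hσ0 k)]
    refine (div_le_self (abs_nonneg _) (one_le_pow₀ hσ1)).trans (h1.trans ?_)
    gcongr ?_ * ε
    -- Here `|M|` is absorbed through `2C² + C ≤ 3C²`. The added `1` keeps the base at least `1`, so
    -- that the exponent `k` may be raised to `2m`.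
    have h2 : (Fintype.card ι * (2 * C ^ 2) + |M|) ≤ Fintype.card ι * (3 * C ^ 2) + 1 := by
      have : (Fintype.card ι : ℝ) * C ≤ Fintype.card ι * C ^ 2 := by
        gcongr
        nlinarith
      linarith
    refine (pow_le_pow_left₀ (by positivity) h2 k).trans (pow_le_pow_right₀ ?_ hk)
    have : 0 ≤ (Fintype.card ι : ℝ) * (3 * C ^ 2) := by positivity
    linarith
  have hcmp := norm_integral_cexp_sub_integral_cexp_le hX hXB hZ hZB hδ t
  have hZ2 : 0 ≤ ∫ ω, Z ω ^ (2 * m) ∂P := integral_nonneg fun ω => (even_two_mul m).pow_nonneg _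
  have htail : |t| ^ (2 * m) / (2 * m).factorial * ∫ ω, Z ω ^ (2 * m) ∂P ≤
      2 * ((1 / 4) ^ m * Real.exp ((2 * |t| + 1) ^ 2)) := by
    have h1 : |t| ^ (2 * m) ≤ (1 / 4) ^ m * (2 * |t| + 1) ^ (2 * m) := by
      rw [pow_mul, pow_mul, ← mul_pow]
      gcongr
      nlinarith [abs_nonneg t]
    calc _ ≤ (1 / 4) ^ m * (2 * |t| + 1) ^ (2 * m) / (2 * m).factorial *
          ∫ ω, Z ω ^ (2 * m) ∂P := by gcongr
      _ = (1 / 4) ^ m * ((2 * |t| + 1) ^ (2 * m) / (2 * m).factorial *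
          ∫ ω, Z ω ^ (2 * m) ∂P) := by ring
      _ ≤ (1 / 4) ^ m * (2 * Real.exp ((2 * |t| + 1) ^ 2)) := by gcongr
      _ = _ := by ring
  refine (norm_sub_le_norm_sub_add_norm_sub _
    (∫ ω, Complex.exp ((t * Z ω : ℝ) * Complex.I) ∂P) _).trans ?_
  linarith

end Quantitative

/-! ### Counting, products of primes, and growth of `Q`. -/

theorem uniformOn_univ_real {α : Type*} [MeasurableSpace α] [MeasurableSingletonClass α] [Finite α]
    (S : Set α) : (uniformOn (Set.univ : Set α)).real S = S.ncard / (Nat.card α : ℝ) := by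
  have := Fintype.ofFinite α
  rw [Measure.real, uniformOn_univ, ENNReal.toReal_div, Nat.card_eq_fintype_card]
  congr 1
  rw [Measure.count_apply_finite S S.toFinite, Set.ncard_eq_toFinset_card S S.toFinite]
  simp

theorem card_primesLE_le (n : ℕ) : (Nat.primesLE n).card ≤ n := by
  have h : Nat.primesLE n ⊆ Finset.Icc 1 n := fun p hp => by
    rw [Nat.mem_primesLE] at hp
    exact Finset.mem_Icc.2 ⟨hp.2.one_lt.le, hp.1⟩
  simpa using Finset.card_le_card h

theorem card_primesLE_floor_le {Q : ℝ} (hQ : 0 ≤ Q) : ((Nat.primesLE ⌊Q⌋₊).card : ℝ) ≤ Q :=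
  le_trans (by exact_mod_cast card_primesLE_le ⌊Q⌋₊) (Nat.floor_le hQ)

theorem prod_natCast_le_pow {n : ℕ} (T : Finset (Nat.primesLE n)) {Q : ℝ} (hn : (n : ℝ) ≤ Q)
    (hQ : 1 ≤ Q) {k : ℕ} (hk : T.card ≤ k) : ((∏ p ∈ T, (p : ℕ) : ℕ) : ℝ) ≤ Q ^ k := by
  rw [Nat.cast_prod]
  refine (Finset.prod_le_prod (g := fun _ => Q) (fun _ _ => Nat.cast_nonneg _) fun p _ => ?_).trans
    ((Finset.prod_const Q).trans_le (pow_le_pow_right₀ hQ hk))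
  exact le_trans (by exact_mod_cast Nat.le_of_mem_primesLE p.2) hn

theorem primeFactors_prod_primesLE {n : ℕ} (T : Finset (Nat.primesLE n)) :
    (∏ p ∈ T, (p : ℕ)).primeFactors = T.map (Function.Embedding.subtype _) := by
  rw [← Nat.primeFactors_prod (s := T.map (Function.Embedding.subtype _))]
  · simp
  · intro p hp
    obtain ⟨a, -, rfl⟩ := Finset.mem_map.1 hp
    exact Nat.prime_of_mem_primesLE a.2

theorem squarefree_prod_primesLE {n : ℕ} (T : Finset (Nat.primesLE n)) :
    Squarefree (∏ p ∈ T, (p : ℕ)) := by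
  refine Finset.squarefree_prod_of_pairwise_isCoprime (fun p _ r _ hpr => ?_) fun p _ =>
    (Nat.prime_of_mem_primesLE p.2).prime.squarefree
  exact Nat.coprime_iff_isRelPrime.1 ((Nat.coprime_primes (Nat.prime_of_mem_primesLE p.2)
    (Nat.prime_of_mem_primesLE r.2)).2 fun h => hpr (Subtype.ext h))

/-- Eventually `Q ^ (a + 1) ≤ E`, hence `Q ^ a / E ≤ 1 / Q`. -/
theorem tendsto_rpow_div_of_log_isLittleO {E Q : ℝ → ℝ} (hE : ∀ N, 0 < E N) (hQ : ∀ N, 0 < Q N)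
    (hE1 : ∀ᶠ N in atTop, 1 ≤ E N)
    (hQE : (fun N => Real.log (Q N)) =o[atTop] fun N => Real.log (E N))
    (hQtop : Tendsto Q atTop atTop) {a : ℝ} (ha : 0 ≤ a) :
    Tendsto (fun N => Q N ^ a / E N) atTop (𝓝 0) := by
  have ha1 : 0 < a + 1 := by linarith
  refine squeeze_zero' (Eventually.of_forall fun N => div_nonneg
    (Real.rpow_nonneg (hQ N).le _) (hE N).le) ?_ (tendsto_inv_atTop_zero.comp hQtop)
  filter_upwards [hE1, hQE.bound (inv_pos.2 ha1)] with N h1 h2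
  have hE0 := hE N
  have hQ0 := hQ N
  rw [Real.norm_eq_abs, Real.norm_eq_abs, abs_of_nonneg (Real.log_nonneg h1)] at h2
  have h3 : Real.log (Q N) * (a + 1) ≤ Real.log (E N) := by
    have := (le_abs_self _).trans h2
    rwa [inv_mul_eq_div, le_div_iff₀ ha1] at this
  have h4 : Q N ^ (a + 1) ≤ E N := by
    rw [Real.rpow_def_of_pos hQ0]
    exact (Real.exp_le_exp.2 h3).trans_eq (Real.exp_log hE0)
  rw [Function.comp_apply, div_le_iff₀ hE0, ← div_eq_inv_mul, le_div_iff₀ hQ0]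
  rwa [Real.rpow_add_one hQ0.ne'] at h4

section Moments

variable {Ω : Type*} [MeasurableSpace Ω] {P : Measure Ω} [IsProbabilityMeasure P] {C : ℝ}
  {Y : ℕ → Ω → ℤ}

theorem stdDevUpTo_sq_le (hYC : ∀ p : ℕ, p.Prime → ∀ᵐ ω ∂P, |(Y p ω : ℝ)| ≤ C)
    {Q : ℝ} (hQ : 0 ≤ Q) : stdDevUpTo P Y Q ^ 2 ≤ (2 * C) ^ 2 * Q := by
  rw [stdDevUpTo, Real.sq_sqrt (Finset.sum_nonneg fun p _ => integral_nonneg fun ω => sq_nonneg _)]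
  have h : ∀ p ∈ Nat.primesLE ⌊Q⌋₊,
      ∫ ω, ((Y p ω : ℝ) - ∫ ω', (Y p ω' : ℝ) ∂P) ^ 2 ∂P ≤ (2 * C) ^ 2 := fun p hp => by
    have hp := hYC p (Nat.prime_of_mem_primesLE hp)
    refine (le_abs_self _).trans (abs_integral_le_of_ae_abs_le (hp.mono fun ω hω => ?_))
    rw [abs_pow]
    refine pow_le_pow_left₀ (abs_nonneg _) ((abs_sub _ _).trans ?_) 2
    linarith [abs_integral_le_of_ae_abs_le hp]
  refine (Finset.sum_le_card_nsmul _ _ _ h).trans ?_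
  rw [nsmul_eq_mul, mul_comm]
  exact mul_le_mul_of_nonneg_left (card_primesLE_floor_le hQ) (by positivity)

/-- At most `Q` primes contribute, each with variance at most `(2C)²`, so `σ(Q)` cannot grow unless
`Q` does. -/
theorem tendsto_atTop_of_stdDevUpTo (hC : 1 ≤ C)
    (hYC : ∀ p : ℕ, p.Prime → ∀ᵐ ω ∂P, |(Y p ω : ℝ)| ≤ C) {Q : ℝ → ℝ} (hQ : ∀ N, 0 < Q N)
    (hσ : Tendsto (fun N => stdDevUpTo P Y (Q N)) atTop atTop) : Tendsto Q atTop atTop := by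
  have h : Tendsto (fun N => stdDevUpTo P Y (Q N) ^ 2 / (2 * C) ^ 2) atTop atTop :=
    ((tendsto_pow_atTop two_ne_zero).comp hσ).atTop_div_const (by positivity)
  refine tendsto_atTop_mono (fun N => ?_) h
  rw [div_le_iff₀' (by positivity)]
  exact stdDevUpTo_sq_le hYC (hQ N).le

end Moments

/-! ### Application to the functions `f p` on `A(N)`. -/

section Sieve

variable {A Ω : Type*} (H : HeightFunction A) [MeasurableSpace Ω] {P : Measure Ω}
  {C κ : ℝ} {f : ℕ → A → ℤ} {Y : ℕ → Ω → ℤ}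

theorem HeightFunction.uniform_real (N : H.Cutoff) (s : A → Prop) :
    @Measure.real _ ⊤ (H.uniform N) {x : H.upTo N | s x} =
      ({x ∈ H.upTo N | s x}.ncard : ℝ) / (H.upTo N).ncard := by
  let _ : MeasurableSpace (H.upTo N) := ⊤
  have h := uniformOn_univ_real (α := H.upTo N) {x | s x}
  have h1 : ({x : H.upTo N | s x}).ncard = {x ∈ H.upTo N | s x}.ncard := by
    rw [← Set.ncard_image_of_injective _ Subtype.val_injective]
    congr 1
    ext x
    simp [and_comm]
  rw [h1] at h
  exact h

/-- Joint distributions of few of the `f p` are close to those of the model. -/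
theorem abs_uniform_real_sub_le (hκ : 0 ≤ κ)
    (hYind : iIndepFun (fun p : Nat.Primes => Y p) P) (N : H.Cutoff) {K E Q : ℝ} (hE : 0 < E)
    (hQ : 1 ≤ Q)
    (hjoint : ∀ q : ℕ, Squarefree q → ∀ lam : ℕ → ℤ, (∀ p ∈ q.primeFactors, lam p ≠ 0) →
        |(({x ∈ H.upTo N | ∀ p ∈ q.primeFactors, f p x = lam p}.ncard : ℝ) / (H.upTo N).ncard) -
            ∏ p ∈ q.primeFactors, P.real {ω | Y p ω = lam p}| ≤ K * ((q : ℝ) ^ κ / E))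
    {k : ℕ} (T : Finset (Nat.primesLE ⌊Q⌋₊)) (hT : T.card ≤ k) (l : Nat.primesLE ⌊Q⌋₊ → ℤ)
    (hl : ∀ p, l p ≠ 0) :
    |@Measure.real _ ⊤ (H.uniform N) {x : H.upTo N | ∀ p ∈ T, f p x = l p} -
        P.real {ω | ∀ p ∈ T, Y p ω = l p}| ≤ |K| * ((Q ^ k) ^ κ / E) := by
  classical
  obtain ⟨lam, hlam, hlam0⟩ : ∃ lam : ℕ → ℤ, (∀ p : Nat.primesLE ⌊Q⌋₊, lam p = l p) ∧
      ∀ p, lam p ≠ 0 := by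
    -- Again `1` is an arbitrary nonzero value, used off the primes up to `Q`.
    refine ⟨fun p => if hp : p ∈ Nat.primesLE ⌊Q⌋₊ then l ⟨p, hp⟩ else 1,
      fun p => dif_pos p.2, fun p => ?_⟩
    simp only
    split_ifs with hp
    · exact hl _
    · exact one_ne_zero
  have h := hjoint _ (squarefree_prod_primesLE T) lam fun p _ => hlam0 p
  rw [primeFactors_prod_primesLE, Finset.prod_map] at h
  simp only [Finset.forall_mem_map, Function.Embedding.subtype_apply, hlam] at h
  have hprod : P.real {ω | ∀ p ∈ T, Y p ω = l p} =
      ∏ p ∈ T, P.real {ω | Y p ω = l p} := by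
    have hind : iIndepFun (fun p : Nat.primesLE ⌊Q⌋₊ => Y p) P :=
      hYind.precomp (g := fun p : Nat.primesLE ⌊Q⌋₊ =>
        (⟨p, Nat.prime_of_mem_primesLE p.2⟩ : Nat.Primes)) fun a b hab =>
          Subtype.ext (congrArg (fun r : Nat.Primes => (r : ℕ)) hab)
    have := hind.measure_inter_preimage_eq_mul T (sets := fun p => {l p})
      fun p _ => measurableSet_singleton _
    simp only [Measure.real, ← ENNReal.toReal_prod]
    congr 1
    refine Eq.trans (congrArg P ?_) this
    ext ω
    simp
  rw [hprod, H.uniform_real N fun x => ∀ p ∈ T, f p x = l p]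
  refine h.trans (mul_le_mul (le_abs_self K) ?_ (by positivity) (abs_nonneg K))
  gcongr
  exact prod_natCast_le_pow T (Nat.floor_le (by linarith)) hQ hT

/-- In the exponent `2m(1 + κ)`, the part `2m` comes from having at most `Q` primes to choose from,
and `2mκ` from `q ^ κ` with `q ≤ Q ^ (2m)`. -/
theorem norm_integral_cexp_uniform_sub_exp_le [IsProbabilityMeasure P] (hC : 1 ≤ C) (hκ : 0 ≤ κ)
    (hf : ∀ p : ℕ, p.Prime → ∀ x : A, |(f p x : ℝ)| ≤ C)
    (hYm : ∀ p : ℕ, p.Prime → Measurable (Y p))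
    (hYind : iIndepFun (fun p : Nat.Primes => Y p) P)
    (hYC : ∀ p : ℕ, p.Prime → ∀ᵐ ω ∂P, |(Y p ω : ℝ)| ≤ C) (N : H.Cutoff) {K E Q : ℝ} (hE : 0 < E)
    (hQ : 1 ≤ Q)
    (hjoint : ∀ q : ℕ, Squarefree q → ∀ lam : ℕ → ℤ, (∀ p ∈ q.primeFactors, lam p ≠ 0) →
        |(({x ∈ H.upTo N | ∀ p ∈ q.primeFactors, f p x = lam p}.ncard : ℝ) / (H.upTo N).ncard) -
            ∏ p ∈ q.primeFactors, P.real {ω | Y p ω = lam p}| ≤ K * ((q : ℝ) ^ κ / E))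
    (hσ : 1 ≤ stdDevUpTo P Y Q) {t : ℝ} (ht : (2 * |t| + 1) * (2 * C / stdDevUpTo P Y Q) ≤ 1)
    (m : ℕ) :
    ‖∫ x, Complex.exp ((t * (((∑ p ∈ Nat.primesLE ⌊Q⌋₊, (f p x : ℝ)) - meanUpTo P Y Q) /
        stdDevUpTo P Y Q) : ℝ) * Complex.I) ∂(H.uniform N) - (Real.exp (-(t ^ 2 / 2)) : ℝ)‖ ≤
      Real.exp |t| * ((4 * C ^ 2) ^ (2 * m) * |K| * (Q ^ (2 * m * (1 + κ)) / E)) +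
        4 * ((1 / 4) ^ m * Real.exp ((2 * |t| + 1) ^ 2)) +
        (|t| ^ 3 * (2 * C / stdDevUpTo P Y Q) + t ^ 4 * (2 * C / stdDevUpTo P Y Q) ^ 2) := by
  let _ : MeasurableSpace (H.upTo N) := ⊤
  have hind : iIndepFun (fun p : Nat.primesLE ⌊Q⌋₊ => Y p) P :=
    hYind.precomp (g := fun p : Nat.primesLE ⌊Q⌋₊ =>
      (⟨p, Nat.prime_of_mem_primesLE p.2⟩ : Nat.Primes)) fun a b hab =>
        Subtype.ext (congrArg (fun r : Nat.Primes => (r : ℕ)) hab)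
  have hpr : ∀ p : Nat.primesLE ⌊Q⌋₊, (p : ℕ).Prime := fun p => Nat.prime_of_mem_primesLE p.2
  have hQ0 : 0 ≤ Q := by linarith
  have hvar : ∑ p : Nat.primesLE ⌊Q⌋₊,
      ∫ ω, ((Y p ω : ℝ) - ∫ ω', (Y p ω' : ℝ) ∂P) ^ 2 ∂P = stdDevUpTo P Y Q ^ 2 := by
    rw [stdDevUpTo, Real.sq_sqrt (Finset.sum_nonneg fun p _ =>
      integral_nonneg fun ω => sq_nonneg _)]
    exact Finset.sum_coe_sort _ fun p => ∫ ω, ((Y p ω : ℝ) - ∫ ω', (Y p ω' : ℝ) ∂P) ^ 2 ∂P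
  have h := norm_integral_cexp_normalized_sum_sub_exp_le (ν := H.uniform N)
    (y := fun (p : Nat.primesLE ⌊Q⌋₊) (x : H.upTo N) => f p x) (m := m) (t := t) hC hind
    (fun _ => measurable_from_top) (fun p => hYm p (hpr p))
    (fun p => ae_of_all _ fun x => hf p (hpr p) x) (fun p => hYC p (hpr p))
    (ε := |K| * ((Q ^ (2 * m)) ^ κ / E)) (by positivity)
    (fun T hT l hl => abs_uniform_real_sub_le H hκ hYind N hE hQ hjoint T hT l hl) hσ hvar ht
  have hmean : ∑ p : Nat.primesLE ⌊Q⌋₊, ∫ ω, (Y p ω : ℝ) ∂P = meanUpTo P Y Q :=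
    Finset.sum_coe_sort _ fun p => ∫ ω, (Y p ω : ℝ) ∂P
  have hsum : ∀ x : A, ∑ p : Nat.primesLE ⌊Q⌋₊, (f p x : ℝ) =
      ∑ p ∈ Nat.primesLE ⌊Q⌋₊, (f p x : ℝ) := fun x =>
    Finset.sum_coe_sort _ fun p => (f p x : ℝ)
  simp_rw [hmean, hsum] at h
  refine h.trans ?_
  gcongr Real.exp |t| * ?_ + _ + _
  have hcard : (Fintype.card (Nat.primesLE ⌊Q⌋₊) : ℝ) ≤ Q := by
    rw [Fintype.card_coe]
    exact card_primesLE_floor_le hQ0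
  have hbase : (Fintype.card (Nat.primesLE ⌊Q⌋₊) : ℝ) * (3 * C ^ 2) + 1 ≤ 4 * C ^ 2 * Q := by
    have h1 : (Fintype.card (Nat.primesLE ⌊Q⌋₊) : ℝ) * (3 * C ^ 2) ≤ Q * (3 * C ^ 2) := by gcongr
    have h2 : 1 ≤ C ^ 2 * Q := one_le_mul_of_one_le_of_one_le (one_le_pow₀ hC) hQ
    linarith
  calc _ ≤ (4 * C ^ 2 * Q) ^ (2 * m) * (|K| * ((Q ^ (2 * m)) ^ κ / E)) := by gcongr
    _ = (4 * C ^ 2) ^ (2 * m) * |K| * (Q ^ (2 * m) * (Q ^ (2 * m)) ^ κ / E) := by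
        rw [mul_pow]
        ring
    _ = _ := by
        congr 2
        rw [← Real.rpow_natCast Q (2 * m), ← Real.rpow_mul hQ0, ← Real.rpow_add (by linarith)]
        congr 1
        push_cast
        ring

end Sieve

/-! ### Lévy continuity and the conclusion. -/

/-- The Lévy continuity theorem along a countably generated filter. -/
theorem tendsto_probabilityMeasure_of_tendsto_charFun {α : Type*} {l : Filter α}
    [l.IsCountablyGenerated] {μ : α → ProbabilityMeasure ℝ} {μ₀ : ProbabilityMeasure ℝ}
    (h : ∀ t : ℝ, Tendsto (fun a => charFun (μ a : Measure ℝ) t) l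
      (𝓝 (charFun (μ₀ : Measure ℝ) t))) : Tendsto μ l (𝓝 μ₀) :=
  tendsto_of_seq_tendsto fun _ hu =>
    ProbabilityMeasure.tendsto_iff_tendsto_charFun.2 fun t => (h t).comp hu

theorem mainTheorem3 {A Ω : Type*} [Infinite A] (H : HeightFunction A)
    [MeasurableSpace Ω] (P : Measure Ω) [IsProbabilityMeasure P]
    (C C' κ : ℝ) (hC : 1 ≤ C) (hC' : 1 ≤ C') (hκ : 1 ≤ κ)
    (f : ℕ → A → ℤ) (hf : ∀ p : ℕ, p.Prime → ∀ x : A, |(f p x : ℝ)| ≤ C)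
    (Y : ℕ → Ω → ℤ) (hYm : ∀ p : ℕ, p.Prime → Measurable (Y p))
    (hYind : iIndepFun (fun p : Nat.Primes => Y p) P)
    (hYC : ∀ p : ℕ, p.Prime → ∀ᵐ ω ∂P, |(Y p ω : ℝ)| ≤ C)
    (E Q : ℝ → ℝ) (hE : ∀ N, 0 < E N) (hQ : ∀ N, 0 < Q N)
    (hE1 : ∀ᶠ N in atTop, 1 ≤ E N)
    (hQE : (fun N => Real.log (Q N)) =o[atTop] fun N => Real.log (E N))
    (hjoint : ∃ K : ℝ, ∀ N : ℝ, C' ≤ N → (H.upTo N).Nonempty →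
      ∀ q : ℕ, Squarefree q → ∀ lam : ℕ → ℤ, (∀ p ∈ q.primeFactors, lam p ≠ 0) →
        |(({x ∈ H.upTo N | ∀ p ∈ q.primeFactors, f p x = lam p}.ncard : ℝ) / (H.upTo N).ncard) -
            ∏ p ∈ q.primeFactors, P.real {ω | Y p ω = lam p}|
          ≤ K * ((q : ℝ) ^ κ / E N))
    (hσ : Tendsto (fun N => stdDevUpTo P Y (Q N)) atTop atTop) :
    TendstoInDistribution
      (fun (N : H.Cutoff) (x : H.upTo N) =>
        ((∑ p ∈ Nat.primesLE ⌊Q N⌋₊, (f p x : ℝ)) - meanUpTo P Y (Q N)) / stdDevUpTo P Y (Q N))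
      H.cutoffAtTop (id : ℝ → ℝ) H.uniform (gaussianReal 0 1) := by
  obtain ⟨K, hK⟩ := hjoint
  let _ : ∀ N : H.Cutoff, MeasurableSpace (H.upTo N) := fun _ => ⊤
  have hmeas : ∀ N : H.Cutoff, AEMeasurable (fun x : H.upTo N =>
      ((∑ p ∈ Nat.primesLE ⌊Q N⌋₊, (f p x : ℝ)) - meanUpTo P Y (Q N)) / stdDevUpTo P Y (Q N))
      (H.uniform N) := fun N => measurable_from_top.aemeasurable
  refine ⟨hmeas, aemeasurable_id, ?_⟩
  have : H.cutoffAtTop.IsCountablyGenerated := by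
    unfold HeightFunction.cutoffAtTop
    infer_instance
  refine tendsto_probabilityMeasure_of_tendsto_charFun fun t => ?_
  simp only [ProbabilityMeasure.coe_mk]
  have hgauss : charFun ((gaussianReal 0 1).map (id : ℝ → ℝ)) t =
      ((Real.exp (-(t ^ 2 / 2)) : ℝ) : ℂ) := by
    rw [Measure.map_id, charFun_gaussianReal]
    simp
  have hchar : ∀ N : H.Cutoff, charFun ((H.uniform N).map fun x : H.upTo N =>
      ((∑ p ∈ Nat.primesLE ⌊Q N⌋₊, (f p x : ℝ)) - meanUpTo P Y (Q N)) / stdDevUpTo P Y (Q N)) t =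
      ∫ x, Complex.exp ((t * (((∑ p ∈ Nat.primesLE ⌊Q N⌋₊, (f p x : ℝ)) - meanUpTo P Y (Q N)) /
        stdDevUpTo P Y (Q N)) : ℝ) * Complex.I) ∂(H.uniform N) := fun N => by
    rw [charFun_apply_real, integral_map (hmeas N)
      (by fun_prop : Continuous fun x : ℝ =>
        Complex.exp (t * x * Complex.I)).aestronglyMeasurable]
    simp only [Complex.ofReal_mul]
  rw [hgauss]
  simp_rw [hchar]
  have hQtop := tendsto_atTop_of_stdDevUpTo hC hYC hQ hσ
  have hb : Tendsto (fun N => 2 * C / stdDevUpTo P Y (Q N)) atTop (𝓝 0) :=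
    hσ.const_div_atTop _
  rw [Metric.tendsto_nhds]
  intro η hη
  -- The truncation error depends only on `t` and `m`, so `m` is fixed before `N` grows; the other
  -- two errors then vanish as `N → ∞`.
  obtain ⟨m, hm⟩ : ∃ m : ℕ, 4 * ((1 / 4) ^ m * Real.exp ((2 * |t| + 1) ^ 2)) < η / 3 := by
    have h : Tendsto (fun m : ℕ => 4 * ((1 / 4 : ℝ) ^ m * Real.exp ((2 * |t| + 1) ^ 2))) atTop
        (𝓝 (4 * (0 * Real.exp ((2 * |t| + 1) ^ 2)))) :=
      ((tendsto_pow_atTop_nhds_zero_of_lt_one (by norm_num) (by norm_num)).mul_const _).const_mul 4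
    rw [zero_mul, mul_zero] at h
    exact (h.eventually_lt_const (by positivity)).exists
  have h1 : ∀ᶠ N in atTop, Real.exp |t| * ((4 * C ^ 2) ^ (2 * m) * |K| *
      (Q N ^ (2 * m * (1 + κ)) / E N)) < η / 3 := by
    have h := ((tendsto_rpow_div_of_log_isLittleO hE hQ hE1 hQE hQtop
      (a := 2 * m * (1 + κ)) (by positivity)).const_mul
        ((4 * C ^ 2) ^ (2 * m) * |K|)).const_mul (Real.exp |t|)
    rw [mul_zero, mul_zero] at h
    exact h.eventually_lt_const (by positivity)
  have h2 : ∀ᶠ N in atTop, |t| ^ 3 * (2 * C / stdDevUpTo P Y (Q N)) +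
      t ^ 4 * (2 * C / stdDevUpTo P Y (Q N)) ^ 2 < η / 3 := by
    have h := (hb.const_mul (|t| ^ 3)).add ((hb.pow 2).const_mul (t ^ 4))
    rw [mul_zero, zero_pow two_ne_zero, mul_zero, add_zero] at h
    exact h.eventually_lt_const (by positivity)
  have h3 : ∀ᶠ N in atTop, (2 * |t| + 1) * (2 * C / stdDevUpTo P Y (Q N)) < 1 := by
    have h := hb.const_mul (2 * |t| + 1)
    rw [mul_zero] at h
    exact h.eventually_lt_const one_pos
  have hall := h1.and (h2.and (h3.and ((hσ.eventually_ge_atTop 1).and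
    ((hQtop.eventually_ge_atTop 1).and (eventually_ge_atTop C')))))
  filter_upwards [hall.comap fun N : H.Cutoff => (N : ℝ)] with N hN
  obtain ⟨g1, g2, g3, g4, g5, g6⟩ := hN
  rw [dist_eq_norm]
  refine (norm_integral_cexp_uniform_sub_exp_le H hC (by linarith) hf hYm hYind hYC N (hE N) g5
    (hK N g6 N.2) g4 g3.le m).trans_lt ?_
  linarith
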